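/- Let $\mathbb N=\{0,1,2,\dots\}$ and let $\mathrm{FIN}$ be the set of all functions $f:\mathbb N\to\mathbb N$ with finite support. For $f,g\in\mathrm{FIN}$ the sum $f+g$ is the pointwise sum, and it is defined only when $f(m)g(m)=0$ for all $m\in\mathbb N$. For $k\in\mathbb N$ let $\mathrm{FIN}_k=\{f\in\mathrm{FIN}:\max(\operatorname{range} f)=k\}$. For $F:\mathbb N\to\mathbb N$ with $F(0)=0$ let $\tilde F:\mathrm{FIN}\to\mathrm{FIN}$, $\tilde F(f)=F\circ f$. Let $\mathcal F$ be the set of all $\tilde F$ with $F$ a nondecreasing surjection (the generalised tetris operations; such $F$ satisfy $F(0)=0$), and let $\mathcal F'$ be the set of all iterates $\tilde T^{(m)}$, $m\in\mathbb N$, of the tetris operation $\tilde T$, where $T(j)=\max\{j-1,0\}$. For a family $\mathcal G$ of maps $\mathrm{FIN}\to\mathrm{FIN}$, a sequence $(f_i)_{i=1}^\infty$ in $\mathrm{FIN}$ is a block sequence with respect to $\mathcal G$ if for all $\ell\ge 1$, $n_1<\dots<n_\ell$ and $G_1,\dots,G_\ell\in\mathcal G$ the sum $G_1(f_{n_1})+\dots+G_\ell(f_{n_\ell})$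 is defined. Then for every colouring of $\mathrm{FIN}$ with finitely many colours and every $n\in\mathbb N$: (1) (Lupini) there is a block sequence $(f_i)_{i=1}^\infty\subseteq\mathrm{FIN}_n$ with respect to $\mathcal F$ such that for every $k\le n$ the set $$\mathrm{FIN}_k\cap\{\tilde F_1(f_{n_1})+\dots+\tilde F_\ell(f_{n_\ell}) : \ell\ge 1,\ n_1<\dots<n_\ell,\ \tilde F_1,\dots,\tilde F_\ell\in\mathcal F\}$$ is monochromatic; (2) (Gowers) there is a block sequence $(f_i)_{i=1}^\infty\subseteq\mathrm{FIN}_n$ with respect to $\mathcal F'$ such that for every $k\le n$ the set $$\mathrm{FIN}_k\cap\{\tilde T^{(m_1)}(f_{n_1})+\dots+\tilde T^{(m_\ell)}(f_{n_\ell}) : \ell\ge 1,\ n_1<\dots<n_\ell,\ m_1,\dots,m_\ell\in\mathbb N\}$$ is monochromatic. -/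

import Mathlib

namespace Gowers

/-- The underlying set of the Gowers semigroup: functions `ℕ → ℕ` with finite support
(the zero function included). -/
abbrev FIN : Type := ℕ →₀ ℕ

/-- The layering map `ℓ(f) = max (range f)`. -/
def layer (f : FIN) : ℕ := f.support.sup f

theorem isGreatest_layer (f : FIN) : IsGreatest (Set.range f) (layer f) := by
  constructor
  · rcases Finset.eq_empty_or_nonempty f.support with h | h
    · refine ⟨0, ?_⟩
      rw [Finsupp.support_eq_empty] at h
      simp [layer, h]
    · obtain ⟨i, _, hi⟩ := Finset.exists_mem_eq_sup f.support h f
      exact ⟨i, hi.symm⟩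
  · rintro _ ⟨i, rfl⟩
    by_cases h : f i = 0
    · simp [h]
    · exact Finset.le_sup (f := f) (Finsupp.mem_support_iff.2 h)

/-- The layer `FIN_k`. -/
def FINk (k : ℕ) : Set FIN := {f | layer f = k}

/-- The partial semigroup operation: `f + g` is the pointwise sum, defined exactly when
`f n * g n = 0` for all `n`. -/
noncomputable def padd (f g : FIN) : Part FIN := ⟨∀ n, f n * g n = 0, fun _ => f + g⟩

/-- The iterated partial sum `t 0 + ⋯ + t ℓ` of `ℓ + 1` terms, bracketed to the left; it is
defined when every intermediate sum is. -/
noncomputable def psum : {ℓ : ℕ} → (Fin (ℓ + 1) → FIN) → Part FIN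
  | 0, t => Part.some (t 0)
  | ℓ + 1, t => (psum (fun i : Fin (ℓ + 1) => t i.castSucc)).bind
      (fun s => padd s (t (Fin.last (ℓ + 1))))

/-- The generalised tetris operations: the maps `f ↦ F ∘ f` on `FIN` with `F : ℕ → ℕ` a
nondecreasing surjection. -/
def tetrisOps : Set (FIN → FIN) :=
  {φ | ∃ F : ℕ → ℕ, Monotone F ∧ Function.Surjective F ∧ ∀ f : FIN, ⇑(φ f) = F ∘ ⇑f}

/-- Gowers' tetris operation, `f ↦ T ∘ f` with `T m = max (m - 1) 0`
(truncated subtraction in `ℕ`). -/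
noncomputable def tetris (f : FIN) : FIN := f.mapRange (fun m => m - 1) rfl

/-- The iterates of Gowers' tetris operation. -/
def tetrisIterates : Set (FIN → FIN) := {φ | ∃ m : ℕ, φ = tetris^[m]}

/-- Block sequences with respect to a family `𝓕` of maps: every sum
`φ₀(x_{n₀}) + ⋯ + φ_ℓ(x_{n_ℓ})` with `n₀ < ⋯ < n_ℓ` and all `φ_i ∈ 𝓕` is defined. -/
def IsBlockSeq (𝓕 : Set (FIN → FIN)) (x : ℕ → FIN) : Prop :=
  ∀ (ℓ : ℕ) (n : Fin (ℓ + 1) → ℕ) (φ : Fin (ℓ + 1) → FIN → FIN),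
    StrictMono n → (∀ i, φ i ∈ 𝓕) → (psum (fun i => φ i (x (n i)))).Dom

/-- The set of all (defined) sums `φ₀(x_{n₀}) + ⋯ + φ_ℓ(x_{n_ℓ})` with `n₀ < ⋯ < n_ℓ` and
all `φ_i ∈ 𝓕`. -/
def sums (𝓕 : Set (FIN → FIN)) (x : ℕ → FIN) : Set FIN :=
  {s | ∃ (ℓ : ℕ) (n : Fin (ℓ + 1) → ℕ) (φ : Fin (ℓ + 1) → FIN → FIN),
    StrictMono n ∧ (∀ i, φ i ∈ 𝓕) ∧ s ∈ psum (fun i => φ i (x (n i)))}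

/-- All elements of `A` have the same colour. -/
def Monochromatic {C : Type*} (c : FIN → C) (A : Set FIN) : Prop :=
  ∃ r : C, ∀ s ∈ A, c s = r

end Gowers

/-!
The iterates of the tetris operation are generalised tetris operations, so a sequence that works
for the latter works for both.

Such a sequence is produced from a *coherent* sequence of ultrafilters `u 0, u 1, u 2, …` on `FIN`,
with `u n` living on the layer `FINk n` and on functions vanishing below any prescribed bound, such
that `u i + u j = u (max i j)` and every nondecreasing surjection `F` maps `u n` to `u (F n)`
(`exists_coherent_seq`, `map_relabel_coherent_seq`). Given a colouring, let `r k` be the colour that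
`u k` picks out. The usual Galvin–Glazer recursion, carried out with all operations at once, builds a
block sequence all of whose sums `s` have colour `r (layer s)` (`exists_blockSeq_of_prolong`,
`exists_blockSeq_monochromatic`).

The construction of the `u n` is purely semigroup theoretic. Let `ψ j` be induced by the surjection
identifying `j` with `j + 1`, and let `S` be induced by the injection `0 ↦ 0`, `i ↦ i + 1` for
`i ≥ 1`. Then `ψ 0 ∘ S = ψ 1 ∘ S = id` and `ψ (j + 2) ∘ S = S ∘ ψ (j + 1)`, and it suffices that
`ψ j` sends `u (n + 1)` to `u n` for all `j ≤ n`. Let `C b` be the closed semigroup generated by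
`b` and `S b`. The next term after `b = u n` is an idempotent `q ≤ b` of `C b` that is minimal among
the idempotents of `C b`; minimality is also what makes the following step possible. Let `a` be the
term before `b`. The maps `ψ 0` and `ψ 1` send `C b` into `{a, b}` and `q` to `b`, because `q` lies
in a minimal left ideal of `C b`. For `2 ≤ j ≤ n` the map `ψ j` sends `C b` into `C a`, so once
`ψ j q ≤ b` is known, minimality of `b` in `C a` gives `ψ j q = b`. For `j = n` this holds since
`q ≤ b` and `ψ n` fixes `b`; for `j < n` all `ψ j` agree with `ψ 2` on `C b`, and `q` is chosen below
an idempotent that `ψ 2` sends to `b`.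
-/

attribute [local instance] Ultrafilter.add Ultrafilter.addSemigroup

namespace Gowers

/-! ### Closed subsemigroups and minimal idempotents -/

section CompactSemigroup

variable {M : Type*} [AddSemigroup M] [TopologicalSpace M]

/-- The smallest closed subsemigroup containing `s`. -/
def closedGen (s : Set M) : AddSubsemigroup M :=
  sInf {T | IsClosed (T : Set M) ∧ s ⊆ T}

theorem subset_closedGen (s : Set M) : s ⊆ closedGen s := fun _ hx =>
  AddSubsemigroup.mem_sInf.2 fun _ hT => hT.2 hx

theorem isClosed_closedGen (s : Set M) : IsClosed (closedGen s : Set M) := by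
  rw [closedGen, AddSubsemigroup.coe_sInf]
  exact isClosed_biInter fun _ hT => hT.1

theorem closedGen_le {s : Set M} {T : AddSubsemigroup M} (hT : IsClosed (T : Set M))
    (hs : s ⊆ T) : closedGen s ≤ T :=
  sInf_le ⟨hT, hs⟩

theorem map_mem_of_mem_closedGen {s : Set M} {T : AddSubsemigroup M} {f : M →ₙ+ M}
    (hf : Continuous f) (hT : IsClosed (T : Set M)) (hs : ∀ x ∈ s, f x ∈ T) {x : M}
    (hx : x ∈ closedGen s) : f x ∈ T := by
  have : closedGen s ≤ T.comap f := closedGen_le (hT.preimage hf) hs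
  exact this hx

theorem eqOn_closedGen [T2Space M] {s : Set M} {f g : M →ₙ+ M} (hf : Continuous f)
    (hg : Continuous g) (hs : Set.EqOn f g s) : Set.EqOn f g (closedGen s) := by
  have : closedGen s ≤ AddHom.eqLocus f g := closedGen_le (isClosed_eq hf hg) hs
  exact fun x hx => this hx

/-- `q` is an idempotent of `C`, minimal for the order `t ≤ q ↔ q + t = t ∧ t + q = t` on the
idempotents of `C`. -/
structure IsMinimalIdempotent (C : AddSubsemigroup M) (q : M) : Prop where
  mem : q ∈ C
  idem : q + q = q
  eq_of_le : ∀ t ∈ C, t + t = t → q + t = t → t + q = t → t = q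

/-- Below every idempotent `p` of a closed subsemigroup `C` of a compact right topological
semigroup there is a minimal one; it may be taken in a minimal left ideal, which gives the last
clause. -/
theorem exists_isMinimalIdempotent_le [CompactSpace M] [T2Space M]
    (hc : ∀ r : M, Continuous (· + r)) {C : AddSubsemigroup M}
    (hC : IsClosed (C : Set M)) {p : M} (hpC : p ∈ C) (hp : p + p = p) :
    ∃ q, IsMinimalIdempotent C q ∧ p + q = q ∧ q + p = q ∧ ∀ z ∈ C, ∃ x ∈ C, q = x + (z + q) := by
  have hclosed : ∀ r : M, IsClosed ((· + r) '' (C : Set M)) := fun r =>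
    (hC.isCompact.image (hc r)).isClosed
  let 𝒮 : Set (Set M) := {L | IsClosed L ∧ L.Nonempty ∧ L ⊆ (· + p) '' (C : Set M) ∧
    ∀ c ∈ C, ∀ l ∈ L, c + l ∈ L}
  have hCp : (· + p) '' (C : Set M) ∈ 𝒮 := by
    refine ⟨hclosed p, ⟨_, p, hpC, rfl⟩, subset_rfl, ?_⟩
    rintro c hcC _ ⟨d, hd, rfl⟩
    exact ⟨c + d, C.add_mem hcC hd, add_assoc c d p⟩
  obtain ⟨L, hL⟩ : ∃ L, Minimal (· ∈ 𝒮) L := by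
    refine zorn_superset 𝒮 fun c hc𝒮 hchain => ?_
    rcases c.eq_empty_or_nonempty with rfl | hne
    · exact ⟨_, hCp, by simp⟩
    refine ⟨⋂₀ c, ⟨?_, ?_, ?_, ?_⟩, fun s hs => Set.sInter_subset_of_mem hs⟩
    · exact isClosed_sInter fun t ht => (hc𝒮 ht).1
    · have := hne.coe_sort
      rw [Set.sInter_eq_iInter]
      exact IsCompact.nonempty_iInter_of_directed_nonempty_isCompact_isClosed _
        (DirectedOn.directed_val (IsChain.directedOn hchain.symm)) (fun i => (hc𝒮 i.2).2.1)
        (fun i => (hc𝒮 i.2).1.isCompact) fun i => (hc𝒮 i.2).1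
    · obtain ⟨t, ht⟩ := hne
      exact (Set.sInter_subset_of_mem ht).trans (hc𝒮 ht).2.2.1
    · exact fun d hd l hl => Set.mem_sInter.2 fun t ht =>
        (hc𝒮 ht).2.2.2 d hd l (Set.mem_sInter.1 hl t ht)
  obtain ⟨hLc, hLne, hLp, hLi⟩ := hL.prop
  have hLC : L ⊆ C := by
    intro l hl
    obtain ⟨c, hcC, rfl⟩ := hLp hl
    exact C.add_mem hcC hpC
  -- Minimality of `L`: every `l ∈ L` generates `L` as a left ideal.
  have hgen : ∀ l ∈ L, ∀ m ∈ L, ∃ x ∈ C, x + l = m := by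
    intro l hl m hm
    have h𝒮 : (· + l) '' (C : Set M) ∈ 𝒮 := by
      refine ⟨hclosed l, ⟨_, p, hpC, rfl⟩, ?_, ?_⟩
      · rintro _ ⟨c, hcC, rfl⟩
        exact hLp (hLi c hcC l hl)
      · rintro c hcC _ ⟨d, hd, rfl⟩
        exact ⟨c + d, C.add_mem hcC hd, add_assoc c d l⟩
    have hsub : (· + l) '' (C : Set M) ⊆ L := by
      rintro _ ⟨c, hcC, rfl⟩
      exact hLi c hcC l hl
    exact hL.le_of_le h𝒮 hsub hm
  obtain ⟨e, heL, he⟩ := exists_idempotent_in_compact_add_subsemigroup hc L hLne hLc.isCompact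
    fun x hx y hy => hLi x (hLC hx) y hy
  have hep : e + p = e := by
    obtain ⟨c, _, rfl⟩ := hLp heL
    simp only [add_assoc, hp]
  have hqL : p + e ∈ L := hLi p hpC e heL
  have hpq : p + (p + e) = p + e := by rw [← add_assoc, hp]
  have hqq : (p + e) + (p + e) = p + e := by
    rw [add_assoc, ← add_assoc e p e, hep, he]
  refine ⟨p + e, ⟨hLC hqL, hqq, ?_⟩, hpq, by rw [add_assoc, hep], ?_⟩
  · intro t htC htt hqt htq
    have htL : t ∈ L := htq ▸ hLi t htC _ hqL
    obtain ⟨x, _, hx⟩ := hgen t htL _ hqL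
    rw [← hqt, ← hx, add_assoc, htt]
  · intro z hz
    obtain ⟨x, hxC, hx⟩ := hgen _ (hLi z hz _ hqL) _ hqL
    exact ⟨x, hxC, hx.symm⟩

/-! ### Coherent sequences of idempotents -/

/-- The stage `n` of the recursive construction: `a` and `b` are consecutive terms of a coherent
sequence, with `b` in layer `n`, so that `ψ j` sends `b` to `a` for `j < n` and fixes it for
`j ≥ n`. From `n = 2` on, `b` is a minimal idempotent of the closed semigroup generated by `a` and
its shift `S a`. -/
structure IsCoherentPair (ψ : ℕ → M →ₙ+ M) (S : M → M) (n : ℕ) (a b : M) : Prop where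
  idem_left : a + a = a
  idem_right : b + b = b
  left_add : a + b = b
  right_add : b + a = b
  map_lt : ∀ j < n, ψ j b = a
  map_ge : ∀ j, n ≤ j → ψ j b = b
  minimal : 2 ≤ n → IsMinimalIdempotent (closedGen {a, S a}) b

variable {ψ : ℕ → M →ₙ+ M} {S : M → M}

theorem IsCoherentPair.map_mem {n : ℕ} {a b : M} (h : IsCoherentPair ψ S n a b) (j : ℕ) :
    ψ j b = a ∨ ψ j b = b :=
  (lt_or_ge j n).imp (h.map_lt j) (h.map_ge j)

theorem add_eq_of_isCoherentPair {u : ℕ → M}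
    (hu : ∀ n, IsCoherentPair ψ S (n + 1) (u n) (u (n + 1))) (i j : ℕ) :
    u i + u j = u (max i j) := by
  have hle : ∀ i d, u i + u (i + d) = u (i + d) ∧ u (i + d) + u i = u (i + d) := by
    intro i d
    induction d with
    | zero => exact ⟨(hu i).idem_left, (hu i).idem_left⟩
    | succ d ih =>
      rw [← add_assoc i d 1]
      have h := hu (i + d)
      constructor
      · rw [← h.left_add, ← add_assoc, ih.1]
      · rw [← h.right_add, add_assoc, ih.2]
  rcases le_total i j with h | h
  · obtain ⟨d, rfl⟩ := Nat.exists_eq_add_of_le h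
    rw [max_eq_right h, (hle i d).1]
  · obtain ⟨d, rfl⟩ := Nat.exists_eq_add_of_le h
    rw [max_eq_left h, (hle j d).2]

variable [CompactSpace M] [T2Space M]

/-- An idempotent below `b` in the closed semigroup generated by `b` and `S b`, which `ψ 2` sends
to `b`. -/
theorem IsCoherentPair.exists_idempotent_map_two (hc : ∀ r : M, Continuous (· + r))
    (hψ : ∀ j, Continuous (ψ j)) (hS : ∀ j x, ψ (j + 2) (S x) = S (ψ (j + 1) x))
    {n : ℕ} {a b : M} (h : IsCoherentPair ψ S n a b) (hn : 2 ≤ n) :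
    ∃ p ∈ closedGen {b, S b}, p + p = p ∧ b + p = p ∧ p + b = p ∧ ψ 2 p = b := by
  have hbC : b ∈ closedGen {b, S b} := subset_closedGen _ (by simp)
  have hb := h.idem_right
  have habs : b + ψ 2 b = b ∧ ψ 2 b + b = b := by
    rcases h.map_mem 2 with e | e <;> rw [e]
    exacts [⟨h.right_add, h.left_add⟩, ⟨hb, hb⟩]
  obtain ⟨x₀, hx₀, hx₀b⟩ : ∃ x ∈ closedGen {b, S b}, ψ 2 x = b := by
    rcases hn.eq_or_lt with rfl | hn
    · exact ⟨b, hbC, h.map_ge 2 le_rfl⟩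
    -- The image of `closedGen {b, S b}` under `ψ 2` is closed and contains `a` and `S a`.
    have hle : closedGen {a, S a} ≤ (closedGen {b, S b}).map (ψ 2) := by
      refine closedGen_le ((isClosed_closedGen _).isCompact.image (hψ 2)).isClosed ?_
      rintro x (rfl | rfl)
      · exact ⟨b, hbC, h.map_lt 2 hn⟩
      · refine ⟨S b, subset_closedGen _ (by simp), ?_⟩
        rw [hS 0, h.map_lt 1 (by lia)]
    exact hle (h.minimal hn.le).mem
  let P : Set M := {x | x ∈ closedGen {b, S b} ∧ ψ 2 x = b}
  have hP : IsClosed P := (isClosed_closedGen _).inter (isClosed_eq (hψ 2) continuous_const)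
  obtain ⟨_, ⟨x, ⟨hxC, hxb⟩, rfl⟩, ht⟩ := exists_idempotent_in_compact_add_subsemigroup hc
    ((· + b) '' P) ⟨_, x₀, ⟨hx₀, hx₀b⟩, rfl⟩ (hP.isCompact.image (hc b)) (by
      rintro _ ⟨x, ⟨hxC, hxb⟩, rfl⟩ _ ⟨y, ⟨hyC, hyb⟩, rfl⟩
      refine ⟨x + b + y, ⟨add_mem (add_mem hxC hbC) hyC, ?_⟩, add_assoc _ _ _⟩
      rw [map_add, map_add, hxb, hyb, habs.1, hb])
  have htb : x + b + b = x + b := by rw [add_assoc, hb]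
  simp only at ht
  refine ⟨b + (x + b), add_mem hbC (add_mem hxC hbC), ?_, ?_, ?_, ?_⟩
  · rw [add_assoc, ← add_assoc (x + b) b, htb, ht]
  · rw [← add_assoc, hb]
  · rw [add_assoc, htb]
  · rw [map_add, map_add, hxb, habs.1, habs.2]

/-- The inductive step: the next term is a minimal idempotent below `b` in the closed semigroup
generated by `b` and `S b`. -/
theorem IsCoherentPair.exists_succ (hc : ∀ r : M, Continuous (· + r))
    (hψ : ∀ j, Continuous (ψ j)) (hS₀ : ∀ x, ψ 0 (S x) = x) (hS₁ : ∀ x, ψ 1 (S x) = x)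
    (hS : ∀ j x, ψ (j + 2) (S x) = S (ψ (j + 1) x))
    {n : ℕ} {a b : M} (h : IsCoherentPair ψ S n a b) (hn : 1 ≤ n) :
    ∃ q, IsCoherentPair ψ S (n + 1) b q := by
  have hbC : b ∈ closedGen {b, S b} := subset_closedGen _ (by simp)
  have hSbC : S b ∈ closedGen {b, S b} := subset_closedGen _ (by simp)
  have hb := h.idem_right
  obtain ⟨p, hpC, hp, hbp, hpb, hp2⟩ : ∃ p ∈ closedGen {b, S b},
      p + p = p ∧ b + p = p ∧ p + b = p ∧ (2 ≤ n → ψ 2 p = b) := by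
    rcases hn.eq_or_lt with rfl | hn
    · exact ⟨b, hbC, hb, hb, hb, by simp⟩
    · obtain ⟨p, hpC, h1, h2, h3, h4⟩ := h.exists_idempotent_map_two hc hψ hS hn
      exact ⟨p, hpC, h1, h2, h3, fun _ => h4⟩
  obtain ⟨q, hq, hpq, hqp, hqI⟩ := exists_isMinimalIdempotent_le hc (isClosed_closedGen _) hpC hp
  have hbq : b + q = q := by rw [← hpq, ← add_assoc, hbp]
  have hqb : q + b = q := by rw [← hqp, add_assoc, hpb]
  -- `ψ 0` and `ψ 1` undo the shift, hence map `closedGen {b, S b}` into `{a, b}`, and `q` to `b`.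
  have hundo : ∀ j, (∀ x, ψ j (S x) = x) → ψ j q = b := by
    intro j hj
    let T : AddSubsemigroup M := ⟨{a, b}, by
      rintro x y (rfl | rfl) (rfl | rfl) <;>
        simp [h.idem_left, h.idem_right, h.left_add, h.right_add]⟩
    have hT : ∀ x ∈ closedGen {b, S b}, ψ j x = a ∨ ψ j x = b := by
      intro x hx
      refine map_mem_of_mem_closedGen (T := T) (hψ j) (Set.toFinite {a, b}).isClosed ?_ hx
      rintro y (rfl | rfl)
      · exact h.map_mem j
      · exact Or.inr (hj b)
    obtain ⟨x, hx, e⟩ := hqI _ hSbC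
    have e' : ψ j q = ψ j x + (b + ψ j q) := by
      conv_lhs => rw [e]
      rw [map_add, map_add, hj]
    rw [e']
    rcases hT x hx with h1 | h1 <;> rcases hT q hq.mem with h2 | h2 <;>
      simp [h1, h2, h.idem_right, h.left_add, h.right_add]
  -- For `j ≥ 2` the image of `q` is an idempotent of `closedGen {a, S a}`; where it lies below
  -- `b`, minimality of `b` there forces equality.
  have hmin : ∀ j, j + 2 ≤ n → ∀ r, r + q = q → q + r = q → ψ (j + 2) r = b →
      ψ (j + 2) q = b := by
    intro j hj r hrq hqr hr
    have hm := h.minimal (by lia)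
    refine hm.eq_of_le _ ?_ (by rw [← map_add, hq.idem]) (by rw [← hr, ← map_add, hrq])
      (by rw [← hr, ← map_add, hqr])
    refine map_mem_of_mem_closedGen (hψ _) (isClosed_closedGen _) ?_ hq.mem
    rintro y (rfl | rfl)
    · rcases h.map_mem (j + 2) with e | e <;> rw [e]
      · exact subset_closedGen _ (by simp)
      · exact hm.mem
    · rw [hS, h.map_lt _ (by lia)]
      exact subset_closedGen _ (by simp)
  refine ⟨q, hb, hq.idem, hbq, hqb, ?_, ?_, fun _ => hq⟩
  · intro j hj
    match j with
    | 0 => exact hundo 0 hS₀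
    | 1 => exact hundo 1 hS₁
    | j + 2 =>
      rcases (Nat.lt_succ_iff.1 hj).eq_or_lt with e | hjn
      · exact hmin j e.le b hbq hqb (h.map_ge _ e.ge)
      · have h2 : ψ 2 q = b := hmin 0 (by lia) p hpq hqp (hp2 (by lia))
        rw [← h2]
        refine eqOn_closedGen (hψ _) (hψ _) ?_ hq.mem
        rintro y (rfl | rfl)
        · rw [h.map_lt _ hjn, h.map_lt 2 (by lia)]
        · rw [hS, hS 0, h.map_lt (j + 1) (by lia), h.map_lt 1 (by lia)]
  · intro j hj
    obtain ⟨j, rfl⟩ : ∃ i, j = i + 2 := ⟨j - 2, by lia⟩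
    refine eqOn_closedGen (g := AddHom.id M) (hψ _) continuous_id ?_ hq.mem
    rintro y (rfl | rfl)
    · exact h.map_ge _ (by lia)
    · rw [hS, h.map_ge _ (by lia)]
      rfl

/-- Every coherent pair in layers `0` and `1` extends to an infinite coherent sequence. -/
theorem IsCoherentPair.exists_seq (hc : ∀ r : M, Continuous (· + r))
    (hψ : ∀ j, Continuous (ψ j)) (hS₀ : ∀ x, ψ 0 (S x) = x) (hS₁ : ∀ x, ψ 1 (S x) = x)
    (hS : ∀ j x, ψ (j + 2) (S x) = S (ψ (j + 1) x))
    {a b : M} (h : IsCoherentPair ψ S 1 a b) :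
    ∃ u : ℕ → M, u 0 = a ∧ u 1 = b ∧ ∀ n, IsCoherentPair ψ S (n + 1) (u n) (u (n + 1)) := by
  choose next hnext using fun (n : ℕ) (s : {s : M × M // IsCoherentPair ψ S (n + 1) s.1 s.2}) =>
    s.2.exists_succ hc hψ hS₀ hS₁ hS (Nat.le_add_left 1 n)
  let f : (n : ℕ) → {s : M × M // IsCoherentPair ψ S (n + 1) s.1 s.2} :=
    Nat.rec ⟨(a, b), h⟩ fun n s => ⟨(s.1.2, next n s), hnext n s⟩
  exact ⟨fun n => (f n).1.1, rfl, rfl, fun n => (f n).2⟩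

end CompactSemigroup

open Filter

/-! ### Relabelling the values of a finitely supported function -/

/-- The map `f ↦ F ∘ f` on `FIN`, for `F : ℕ → ℕ` with `F 0 = 0`. -/
noncomputable def relabel (F : ZeroHom ℕ ℕ) (f : FIN) : FIN := f.mapRange F (map_zero F)

@[simp]
theorem relabel_apply (F : ZeroHom ℕ ℕ) (f : FIN) (i : ℕ) : relabel F f i = F (f i) := rfl

theorem relabel_comp (F G : ZeroHom ℕ ℕ) (f : FIN) :
    relabel (F.comp G) f = relabel F (relabel G f) := by
  ext i
  simp

theorem relabel_add (F : ZeroHom ℕ ℕ) {f g : FIN} (h : ∀ i, f i * g i = 0) :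
    relabel F (f + g) = relabel F f + relabel F g := by
  ext i
  rcases Nat.mul_eq_zero.1 (h i) with h | h <;> simp [h]

theorem le_layer (f : FIN) (i : ℕ) : f i ≤ layer f :=
  (isGreatest_layer f).2 ⟨i, rfl⟩

theorem layer_relabel {F : ZeroHom ℕ ℕ} (hF : Monotone F) (f : FIN) :
    layer (relabel F f) = F (layer f) := by
  refine (isGreatest_layer _).unique ?_
  have : ⇑(relabel F f) = F ∘ f := rfl
  rw [this, Set.range_comp]
  exact hF.map_isGreatest (isGreatest_layer f)

theorem layer_add {f g : FIN} (h : ∀ i, f i * g i = 0) :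
    layer (f + g) = max (layer f) (layer g) := by
  refine le_antisymm ?_ (max_le ?_ ?_)
  · obtain ⟨i, hi⟩ := (isGreatest_layer (f + g)).1
    rw [← hi]
    rcases Nat.mul_eq_zero.1 (h i) with h | h <;> simp [h, le_layer]
  · obtain ⟨i, hi⟩ := (isGreatest_layer f).1
    exact hi ▸ (Nat.le_add_right _ _).trans (le_layer (f + g) i)
  · obtain ⟨i, hi⟩ := (isGreatest_layer g).1
    exact hi ▸ (Nat.le_add_left _ _).trans (le_layer (f + g) i)

theorem eq_zero_of_layer_eq_zero {f : FIN} (h : layer f = 0) : f = 0 := by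
  ext i
  exact Nat.le_zero.1 (h ▸ le_layer f i)

theorem relabel_congr {F G : ZeroHom ℕ ℕ} {f : FIN} (h : ∀ i ≤ layer f, F i = G i) :
    relabel F f = relabel G f := by
  ext i
  exact h _ (le_layer f i)

/-- The nondecreasing surjection of `ℕ` identifying `j` and `j + 1`. -/
def collapse (j : ℕ) : ZeroHom ℕ ℕ := ⟨fun i => if j < i then i - 1 else i, by simp⟩

theorem collapse_apply (j i : ℕ) : collapse j i = if j < i then i - 1 else i := rfl

/-- The map fixing `0` and sending `i` to `i + 1` for `i ≥ 1`. -/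
def shift : ZeroHom ℕ ℕ := ⟨fun i => if i = 0 then 0 else i + 1, by simp⟩

theorem shift_apply (i : ℕ) : shift i = if i = 0 then 0 else i + 1 := rfl

theorem collapse_zero_comp_shift : (collapse 0).comp shift = ZeroHom.id ℕ := by
  ext i
  simp only [ZeroHom.comp_apply, collapse_apply, shift_apply, ZeroHom.id_apply]
  grind

theorem collapse_one_comp_shift : (collapse 1).comp shift = ZeroHom.id ℕ := by
  ext i
  simp only [ZeroHom.comp_apply, collapse_apply, shift_apply, ZeroHom.id_apply]
  grind

theorem collapse_comp_shift (j : ℕ) :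
    (collapse (j + 2)).comp shift = shift.comp (collapse (j + 1)) := by
  ext i
  simp only [ZeroHom.comp_apply, collapse_apply, shift_apply]
  grind

/-! ### Ultrafilters on tails -/

/-- The compact semigroup of ultrafilters on `FIN` containing, for every `m`, the set of all `f`
that vanish below `m`. On it every `relabel F` acts by endomorphisms, although `relabel F` is
additive only on functions with disjoint supports. -/
def tailUltrafilters : AddSubsemigroup (Ultrafilter FIN) where
  carrier := {u | ∀ m, ∀ᶠ f in (u : Filter FIN), ∀ i < m, f i = 0}
  add_mem' {u v} hu hv m := by
    rw [Ultrafilter.eventually_add]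
    filter_upwards [hu m] with f hf
    filter_upwards [hv m] with g hg i hi
    simp [hf i hi, hg i hi]

theorem isClosed_tailUltrafilters : IsClosed (tailUltrafilters : Set (Ultrafilter FIN)) := by
  have : (tailUltrafilters : Set (Ultrafilter FIN)) =
      ⋂ m : ℕ, {u | {f : FIN | ∀ i < m, f i = 0} ∈ u} := by
    ext u
    simp only [Set.mem_iInter]
    rfl
  rw [this]
  exact isClosed_iInter fun m => ultrafilter_isClosed_basic _

instance : CompactSpace tailUltrafilters :=
  isCompact_iff_compactSpace.1 isClosed_tailUltrafilters.isCompact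

theorem continuous_tailUltrafilters_add (r : tailUltrafilters) : Continuous (· + r) :=
  ((Ultrafilter.continuous_add_left r.1).comp continuous_subtype_val).subtype_mk _

theorem eventually_disjoint {v : Ultrafilter FIN} (hv : v ∈ tailUltrafilters) (f : FIN) :
    ∀ᶠ g in (v : Filter FIN), ∀ i, f i * g i = 0 := by
  filter_upwards [hv (f.support.sup id + 1)] with g hg i
  by_cases hi : f i = 0
  · simp [hi]
  · have : i ≤ f.support.sup id := Finset.le_sup (f := id) (Finsupp.mem_support_iff.2 hi)
    simp [hg i (Nat.lt_succ_of_le this)]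

theorem map_relabel_mem {u : Ultrafilter FIN} (hu : u ∈ tailUltrafilters) (F : ZeroHom ℕ ℕ) :
    u.map (relabel F) ∈ tailUltrafilters := by
  intro m
  rw [Ultrafilter.coe_map, eventually_map]
  filter_upwards [hu m] with f hf i hi
  simp [hf i hi]

theorem map_relabel_add (u : Ultrafilter FIN) {v : Ultrafilter FIN} (hv : v ∈ tailUltrafilters)
    (F : ZeroHom ℕ ℕ) :
    (u + v).map (relabel F) = u.map (relabel F) + v.map (relabel F) := by
  refine Ultrafilter.coe_inj.1 (Filter.ext' fun p => ?_)
  simp only [Ultrafilter.coe_map, eventually_map, Ultrafilter.eventually_add]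
  refine eventually_congr (Eventually.of_forall fun f => eventually_congr ?_)
  filter_upwards [eventually_disjoint hv f] with g hg
  rw [relabel_add F hg]

theorem map_congr_of_eventually {α β : Type*} {u : Ultrafilter α} {f g : α → β}
    (h : ∀ᶠ x in (u : Filter α), f x = g x) : u.map f = u.map g :=
  Ultrafilter.coe_inj.1 (by simpa only [Ultrafilter.coe_map] using Filter.map_congr h)

theorem continuous_ultrafilter_map {α β : Type*} (f : α → β) :
    Continuous (Ultrafilter.map f) :=
  ultrafilterBasis_is_basis.continuous_iff.2 <| Set.forall_mem_range.2 fun s =>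
    ultrafilter_isOpen_basic (f ⁻¹' s)

/-- The continuous endomorphism of `tailUltrafilters` induced by `f ↦ F ∘ f`. -/
noncomputable def tailMap (F : ZeroHom ℕ ℕ) : tailUltrafilters →ₙ+ tailUltrafilters where
  toFun u := ⟨u.1.map (relabel F), map_relabel_mem u.2 F⟩
  map_add' u v := Subtype.ext (map_relabel_add u.1 v.2 F)

theorem continuous_tailMap (F : ZeroHom ℕ ℕ) : Continuous (tailMap F) :=
  ((continuous_ultrafilter_map _).comp continuous_subtype_val).subtype_mk _

theorem tailMap_comp (F G : ZeroHom ℕ ℕ) (u : tailUltrafilters) :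
    tailMap F (tailMap G u) = tailMap (F.comp G) u := by
  refine Subtype.ext ((Ultrafilter.map_map _ _ _).trans (map_congr_of_eventually ?_))
  exact Eventually.of_forall fun f => (relabel_comp F G f).symm

theorem tailMap_id (u : tailUltrafilters) : tailMap (ZeroHom.id ℕ) u = u := by
  refine Subtype.ext (Eq.trans (map_congr_of_eventually ?_) (Ultrafilter.map_id _))
  exact Eventually.of_forall fun f => by ext; rfl

theorem pure_zero_mem : (pure 0 : Ultrafilter FIN) ∈ tailUltrafilters := fun _ =>
  (mem_pure.2 fun _ _ => rfl)

theorem pure_zero_add (u : Ultrafilter FIN) : (pure 0 : Ultrafilter FIN) + u = u := by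
  refine Ultrafilter.coe_inj.1 (Filter.ext' fun p => ?_)
  rw [Ultrafilter.eventually_add, Ultrafilter.coe_pure, eventually_pure]
  simp

theorem add_pure_zero (u : Ultrafilter FIN) : u + (pure 0 : Ultrafilter FIN) = u := by
  refine Ultrafilter.coe_inj.1 (Filter.ext' fun p => ?_)
  simp [Ultrafilter.eventually_add]

/-- An idempotent living on the characteristic functions of nonempty finite sets. -/
theorem exists_idempotent_layer_one :
    ∃ v : tailUltrafilters, v + v = v ∧ ∀ᶠ f in (v.1 : Filter FIN), layer f = 1 := by
  let s : Set tailUltrafilters := {v | {f : FIN | layer f = 1} ∈ v.1}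
  have hs : IsClosed s := (ultrafilter_isClosed_basic _).preimage continuous_subtype_val
  have hne : s.Nonempty := by
    refine ⟨⟨(hyperfilter ℕ).map fun m => Finsupp.single m 1, fun m => ?_⟩, ?_⟩
    · rw [Ultrafilter.coe_map, eventually_map]
      have : ∀ᶠ k in (hyperfilter ℕ : Filter ℕ), m ≤ k :=
        Nat.hyperfilter_le_atTop (eventually_ge_atTop m)
      filter_upwards [this] with k hk i hi
      exact Finsupp.single_eq_of_ne (by lia)
    · refine Filter.univ_mem' fun m => ?_
      simp [layer]
  obtain ⟨v, hv, hvv⟩ := exists_idempotent_in_compact_add_subsemigroup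
    continuous_tailUltrafilters_add s hne hs.isCompact (by
      intro u hu v hv
      change ∀ᶠ f in ((u.1 + v.1 : Ultrafilter FIN) : Filter FIN), layer f = 1
      rw [Ultrafilter.eventually_add]
      filter_upwards [hu] with f hf
      filter_upwards [hv, eventually_disjoint v.2 f] with g hg hfg
      simp_all [layer_add hfg])
  exact ⟨v, hvv, hv⟩

theorem eventually_layer_succ {n : ℕ} (hn : 0 < n) {v : tailUltrafilters}
    (h : ∀ᶠ f in ((tailMap (collapse 0) v).1 : Filter FIN), layer f = n) :
    ∀ᶠ f in (v.1 : Filter FIN), layer f = n + 1 := by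
  have h' : ∀ᶠ f in (v.1 : Filter FIN), layer (relabel (collapse 0) f) = n := h
  have hmono : Monotone (collapse 0) := by
    intro i j hij
    simp only [collapse_apply]
    grind
  filter_upwards [h'] with f hf
  rw [layer_relabel hmono, collapse_apply] at hf
  grind

/-- A coherent sequence of ultrafilters, one for each layer. -/
theorem exists_coherent_seq : ∃ u : ℕ → tailUltrafilters,
    u 0 = ⟨pure 0, pure_zero_mem⟩ ∧ (∀ n, ∀ᶠ f in ((u n).1 : Filter FIN), layer f = n) ∧
    (∀ i j, u i + u j = u (max i j)) ∧ ∀ n, ∀ j ≤ n, tailMap (collapse j) (u (n + 1)) = u n := by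
  obtain ⟨v, hvv, hv⟩ := exists_idempotent_layer_one
  have h01 : IsCoherentPair (fun j => tailMap (collapse j)) (tailMap shift) 1
      ⟨pure 0, pure_zero_mem⟩ v := by
    refine ⟨Subtype.ext (pure_zero_add _), hvv, Subtype.ext (pure_zero_add _),
      Subtype.ext (add_pure_zero _), ?_, ?_, by simp⟩
    · intro j hj
      obtain rfl : j = 0 := by lia
      have : v.1.map (relabel (collapse 0)) = v.1.map fun _ => 0 := by
        refine map_congr_of_eventually ?_
        filter_upwards [hv] with f hf
        ext i
        have := le_layer f i
        simp [collapse_apply]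
        lia
      refine Subtype.ext (this.trans (Ultrafilter.coe_inj.1 ?_))
      exact Filter.map_const
    · intro j hj
      have : v.1.map (relabel (collapse j)) = v.1.map id := by
        refine map_congr_of_eventually ?_
        filter_upwards [hv] with f hf
        ext i
        have := le_layer f i
        simp [collapse_apply]
        lia
      exact Subtype.ext (this.trans (Ultrafilter.map_id _))
  obtain ⟨u, hu0, hu1, hu⟩ := h01.exists_seq continuous_tailUltrafilters_add
    (fun j => continuous_tailMap _)
    (fun x => by rw [tailMap_comp, collapse_zero_comp_shift, tailMap_id])
    (fun x => by rw [tailMap_comp, collapse_one_comp_shift, tailMap_id])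
    (fun j x => by rw [tailMap_comp, tailMap_comp, collapse_comp_shift])
  refine ⟨u, hu0, ?_, add_eq_of_isCoherentPair hu,
    fun n j hj => (hu n).map_lt j (Nat.lt_succ_of_le hj)⟩
  intro n
  induction n with
  | zero =>
    rw [hu0]
    exact mem_pure.2 (by simp [layer])
  | succ n ih =>
    rcases n.eq_zero_or_pos with rfl | hn
    · rwa [← hu1] at hv
    · exact eventually_layer_succ hn (by rwa [(hu n).map_lt 0 n.succ_pos])

/-- A slowly increasing map factors through collapses until it is injective on the values that
matter, so a coherent sequence is compatible with it. -/
theorem map_relabel_coherent_seq {u : ℕ → tailUltrafilters}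
    (hlayer : ∀ n, ∀ᶠ f in ((u n).1 : Filter FIN), layer f = n)
    (hcol : ∀ n, ∀ j ≤ n, tailMap (collapse j) (u (n + 1)) = u n) (n : ℕ) (F : ZeroHom ℕ ℕ)
    (hF : ∀ i, F (i + 1) = F i ∨ F (i + 1) = F i + 1) : tailMap F (u n) = u (F n) := by
  induction n generalizing F with
  | zero =>
    rw [map_zero]
    refine Subtype.ext (Eq.trans (map_congr_of_eventually ?_) (Ultrafilter.map_id _))
    filter_upwards [hlayer 0] with f hf
    rw [eq_zero_of_layer_eq_zero hf]
    ext i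
    simp
  | succ n ih =>
    by_cases hinj : ∀ i ≤ n, F (i + 1) = F i + 1
    · have hid : ∀ i ≤ n + 1, F i = i := by
        intro i hi
        induction i with
        | zero => exact map_zero F
        | succ i ihi => rw [hinj i (by lia), ihi (by lia)]
      rw [hid _ le_rfl]
      refine Subtype.ext (Eq.trans (map_congr_of_eventually ?_) (Ultrafilter.map_id _))
      filter_upwards [hlayer (n + 1)] with f hf
      ext i
      exact hid _ (hf ▸ le_layer f i)
    · push Not at hinj
      obtain ⟨j, hjn, hj⟩ := hinj
      have hj' : F (j + 1) = F j := (hF j).resolve_right hj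
      let G : ZeroHom ℕ ℕ := ⟨fun i => if i ≤ j then F i else F (i + 1), by simp⟩
      have hG : ∀ i, G i = if i ≤ j then F i else F (i + 1) := fun _ => rfl
      have hFG : F = G.comp (collapse j) := by
        ext i
        rw [ZeroHom.comp_apply, hG, collapse_apply]
        grind
      have hGn : G n = F (n + 1) := by
        rw [hG]
        grind
      rw [hFG, ← tailMap_comp, hcol n j hjn, ih G fun i => by rw [hG, hG]; grind, ← hFG, hGn]

/-! ### Block sequences from coherent ultrafilters -/

/-- The generalised tetris operations are the maps `relabel F` for `F` nondecreasing and
surjective; such `F` fixes `0` and has increments at most one. -/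
theorem exists_relabel_of_mem_tetrisOps {φ : FIN → FIN} (hφ : φ ∈ tetrisOps) :
    ∃ F : ZeroHom ℕ ℕ, (∀ i, F (i + 1) = F i ∨ F (i + 1) = F i + 1) ∧
      ∀ f, φ f = relabel F f := by
  obtain ⟨F, hmono, hsurj, hφ⟩ := hφ
  have h0 : F 0 = 0 := by
    obtain ⟨i, hi⟩ := hsurj 0
    exact Nat.le_zero.1 ((hmono (Nat.zero_le i)).trans_eq hi)
  refine ⟨⟨F, h0⟩, fun i => ?_, fun f => DFunLike.coe_injective (hφ f)⟩
  change F (i + 1) = F i ∨ F (i + 1) = F i + 1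
  obtain ⟨k, hk⟩ := hsurj (F i + 1)
  have h1 := hmono (Nat.le_succ i)
  rcases le_or_gt k i with h | h
  · have := hmono h
    lia
  · have := hmono (Nat.succ_le_of_lt h)
    simp only [Nat.succ_eq_add_one] at *
    lia

theorem le_self_of_increments {F : ZeroHom ℕ ℕ}
    (hF : ∀ i, F (i + 1) = F i ∨ F (i + 1) = F i + 1) (i : ℕ) : F i ≤ i := by
  induction i with
  | zero => exact (map_zero F).le
  | succ i ih => rcases hF i with h | h <;> lia

theorem tetrisIterates_subset_tetrisOps : tetrisIterates ⊆ tetrisOps := by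
  rintro _ ⟨m, rfl⟩
  refine ⟨fun i => i - m, fun i j h => Nat.sub_le_sub_right h m,
    fun i => ⟨i + m, Nat.add_sub_cancel i m⟩, fun f => ?_⟩
  funext i
  induction m with
  | zero => rfl
  | succ m ih =>
    rw [Function.iterate_succ_apply']
    simp only [tetris, Finsupp.mapRange_apply, Function.comp_apply] at ih ⊢
    rw [ih, Nat.sub_sub]

/-- A property that holds eventually for each single `relabel F` holds eventually for all `F`
simultaneously: on one layer only finitely many different operations occur. -/
theorem eventually_forall_relabel {v : Ultrafilter FIN} {n : ℕ}
    (hv : ∀ᶠ f in (v : Filter FIN), layer f = n) {K : Set (ZeroHom ℕ ℕ)}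
    (hK : ∀ F ∈ K, ∀ i ≤ n, F i ≤ n) {p : FIN → Prop}
    (hp : ∀ F ∈ K, ∀ᶠ f in (v : Filter FIN), p (relabel F f)) :
    ∀ᶠ f in (v : Filter FIN), ∀ F ∈ K, p (relabel F f) := by
  have key : ∀ κ : Fin (n + 1) → Fin (n + 1), ∀ᶠ f in (v : Filter FIN), ∀ F ∈ K,
      (∀ i : Fin (n + 1), F i = κ i) → p (relabel F f) := by
    intro κ
    by_cases h : ∃ F ∈ K, ∀ i : Fin (n + 1), F i = κ i
    · obtain ⟨F₀, hF₀, hκ₀⟩ := h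
      filter_upwards [hv, hp F₀ hF₀] with f hf hpf F hF hκ
      rwa [relabel_congr (G := F₀)]
      intro i hi
      exact (hκ ⟨i, by lia⟩).trans (hκ₀ ⟨i, by lia⟩).symm
    · exact Eventually.of_forall fun f F hF hκ => (h ⟨F, hF, hκ⟩).elim
  filter_upwards [eventually_all.2 key] with f hf F hF
  exact hf (fun i => ⟨F i, Nat.lt_succ_of_le (hK F hF i (Nat.le_of_lt_succ i.2))⟩) F hF
    fun i => rfl

theorem finite_image_tetrisOps (x : FIN) : {g | ∃ φ ∈ tetrisOps, φ x = g}.Finite := by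
  refine (Set.finite_Iic x).subset ?_
  rintro _ ⟨φ, hφ, rfl⟩
  obtain ⟨F, hF, hφF⟩ := exists_relabel_of_mem_tetrisOps hφ
  rw [hφF]
  exact fun i => le_self_of_increments hF (x i)

/-- If every finite set of partial sums inside `A` can be prolonged by some `x` in layer `n`, then
iterating yields a block sequence all of whose sums lie in `A`. -/
theorem exists_blockSeq_of_prolong {A : Set FIN} {n : ℕ} (h0 : 0 ∈ A)
    (hstep : ∀ B : Set FIN, B.Finite → B ⊆ A → ∃ x ∈ FINk n, ∀ s ∈ B,
      (∀ i, s i * x i = 0) ∧ ∀ φ ∈ tetrisOps, s + φ x ∈ A) :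
    ∃ x : ℕ → FIN, (∀ i, x i ∈ FINk n) ∧ IsBlockSeq tetrisOps x ∧ sums tetrisOps x ⊆ A := by
  choose X hXn hX using fun B : {B : Set FIN // B.Finite ∧ B ⊆ A} => hstep B.1 B.2.1 B.2.2
  -- `B m` is the set of all partial sums formed from the first `m` terms, including `0`.
  let B : ℕ → {B : Set FIN // B.Finite ∧ B ⊆ A} := Nat.rec ⟨{0}, Set.finite_singleton 0, by simpa⟩
    fun _ B => ⟨B.1 ∪ Set.image2 (· + ·) B.1 {g | ∃ φ ∈ tetrisOps, φ (X B) = g},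
      B.2.1.union (B.2.1.image2 _ (finite_image_tetrisOps _)), by
        rintro _ (hs | ⟨s, hs, _, ⟨φ, hφ, rfl⟩, rfl⟩)
        exacts [B.2.2 hs, (hX B s hs).2 φ hφ]⟩
  have hB : ∀ m, (B (m + 1)).1 =
      (B m).1 ∪ Set.image2 (· + ·) (B m).1 {g | ∃ φ ∈ tetrisOps, φ (X (B m)) = g} := fun _ => rfl
  have hmono : Monotone fun m => (B m).1 :=
    monotone_nat_of_le_succ fun m => by rw [hB]; exact Set.subset_union_left
  have h0B : ∀ m, (0 : FIN) ∈ (B m).1 := fun m => hmono (Nat.zero_le m) (Set.mem_singleton 0)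
  have hadd : ∀ m, ∀ s ∈ (B m).1, ∀ φ ∈ tetrisOps, s + φ (X (B m)) ∈ (B (m + 1)).1 := by
    intro m s hs φ hφ
    rw [hB]
    exact Or.inr ⟨s, hs, _, ⟨φ, hφ, rfl⟩, rfl⟩
  have hpsum : ∀ (ℓ : ℕ) (k : Fin (ℓ + 1) → ℕ) (φ : Fin (ℓ + 1) → FIN → FIN), StrictMono k →
      (∀ i, φ i ∈ tetrisOps) → ∃ s ∈ (B (k (Fin.last ℓ) + 1)).1,
        psum (fun i => φ i (X (B (k i)))) = Part.some s := by
    intro ℓ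
    induction ℓ with
    | zero =>
      intro k φ _ hφ
      exact ⟨_, by simpa using hadd _ 0 (h0B (k 0)) _ (hφ 0), rfl⟩
    | succ ℓ ih =>
      intro k φ hk hφ
      obtain ⟨s, hs, hps⟩ := ih (fun i => k i.castSucc) (fun i => φ i.castSucc)
        (hk.comp Fin.strictMono_castSucc) fun i => hφ _
      have hlt : k (Fin.last ℓ).castSucc < k (Fin.last (ℓ + 1)) := hk (Fin.castSucc_lt_last _)
      have hs' : s ∈ (B (k (Fin.last (ℓ + 1)))).1 := hmono (Nat.succ_le_of_lt hlt) hs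
      refine ⟨_, hadd _ s hs' _ (hφ (Fin.last (ℓ + 1))), ?_⟩
      rw [psum, hps, Part.bind_some]
      refine Part.eq_some_iff.2 ⟨fun i => ?_, rfl⟩
      obtain ⟨F, -, hF⟩ := exists_relabel_of_mem_tetrisOps (hφ (Fin.last (ℓ + 1)))
      rcases Nat.mul_eq_zero.1 ((hX _ s hs').1 i) with h | h <;> simp [hF, h]
  refine ⟨fun i => X (B i), fun i => hXn _, ?_, ?_⟩
  · intro ℓ k φ hk hφ
    obtain ⟨s, -, hs⟩ := hpsum ℓ k φ hk hφ
    rw [hs]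
    trivial
  · rintro t ⟨ℓ, k, φ, hk, hφ, ht⟩
    obtain ⟨s, hsB, hs⟩ := hpsum ℓ k φ hk hφ
    rw [hs, Part.mem_some_iff] at ht
    rw [ht]
    exact (B (k (Fin.last ℓ) + 1)).2.2 hsB

/-- The colour of a sum of generalised tetris images can be made to depend only on its layer. -/
theorem exists_blockSeq_monochromatic {C : Type*} [Finite C] (c : FIN → C) (n : ℕ) :
    ∃ x : ℕ → FIN, (∀ i, x i ∈ FINk n) ∧ IsBlockSeq tetrisOps x ∧
      ∀ k ≤ n, Monochromatic c (FINk k ∩ sums tetrisOps x) := by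
  obtain ⟨u, hu0, hlayer, hadd, hcol⟩ := exists_coherent_seq
  have hmap := map_relabel_coherent_seq hlayer hcol
  have hcolour : ∀ k, ∃ r, ∀ᶠ f in ((u k).1 : Filter FIN), c f = r := fun k =>
    Ultrafilter.eventually_exists_iff.1 (Eventually.of_forall fun f => ⟨c f, rfl⟩)
  choose r hr using hcolour
  let A : Set FIN := {f | c f = r (layer f)}
  have hA : ∀ k, ∀ᶠ f in ((u k).1 : Filter FIN), f ∈ A := fun k => by
    filter_upwards [hr k, hlayer k] with f h1 h2
    exact h1.trans (h2 ▸ rfl)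
  -- `A'` is the part of `A` from which every further step stays in `A`.
  let A' : Set FIN := {s | ∀ k ≤ n, ∀ᶠ g in ((u k).1 : Filter FIN), s + g ∈ A}
  have hA'A : A' ⊆ A := by
    intro s hs
    have := hs 0 (Nat.zero_le n)
    rw [hu0] at this
    simpa using mem_pure.1 this
  have h0 : (0 : FIN) ∈ A' := fun k _ => by simpa using hA k
  have hA' : ∀ s ∈ A', ∀ k ≤ n, ∀ᶠ g in ((u k).1 : Filter FIN), s + g ∈ A' := by
    intro s hs k hk
    have : ∀ᶠ g in ((u k).1 : Filter FIN), ∀ j ∈ Set.Iic n,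
        ∀ᶠ h in ((u j).1 : Filter FIN), s + g + h ∈ A := by
      refine (eventually_all_finite (Set.finite_Iic n)).2 fun j hj => ?_
      have h := hs _ (max_le hk hj)
      rw [← hadd k j] at h
      simpa only [add_assoc] using (Ultrafilter.eventually_add _ _ _).1 h
    exact this
  have hstep : ∀ B : Set FIN, B.Finite → B ⊆ A' → ∃ x ∈ FINk n, ∀ s ∈ B,
      (∀ i, s i * x i = 0) ∧ ∀ φ ∈ tetrisOps, s + φ x ∈ A' := by
    intro B hB hBA
    let K : Set (ZeroHom ℕ ℕ) := {F | ∀ i, F (i + 1) = F i ∨ F (i + 1) = F i + 1}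
    have h1 : ∀ᶠ x in ((u n).1 : Filter FIN), ∀ s ∈ B, ∀ i, s i * x i = 0 :=
      (eventually_all_finite hB).2 fun s _ => eventually_disjoint (u n).2 s
    have h2 : ∀ᶠ x in ((u n).1 : Filter FIN), ∀ s ∈ B, ∀ F ∈ K, s + relabel F x ∈ A' := by
      refine (eventually_all_finite hB).2 fun s hs => ?_
      refine eventually_forall_relabel (p := fun g => s + g ∈ A') (hlayer n)
        (fun F hF i hi => (le_self_of_increments hF i).trans hi) fun F hF => ?_
      have := hA' s (hBA hs) (F n) (le_self_of_increments hF n)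
      rw [← hmap n F hF] at this
      exact this
    obtain ⟨x, hxn, hx1, hx2⟩ := ((hlayer n).and (h1.and h2)).exists
    refine ⟨x, hxn, fun s hs => ⟨hx1 s hs, fun φ hφ => ?_⟩⟩
    obtain ⟨F, hF, hφF⟩ := exists_relabel_of_mem_tetrisOps hφ
    exact hφF x ▸ hx2 s hs F hF
  obtain ⟨x, hxn, hx, hsums⟩ := exists_blockSeq_of_prolong h0 hstep
  refine ⟨x, hxn, hx, fun k _ => ⟨r k, ?_⟩⟩
  rintro s ⟨hsk, hs⟩
  have : c s = r (layer s) := hA'A (hsums hs)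
  rwa [show layer s = k from hsk] at this

end Gowers

theorem mainTheorem5 {C : Type*} [Finite C] (c : Gowers.FIN → C) (n : ℕ) :
    (∃ x : ℕ → Gowers.FIN,
      (∀ i, x i ∈ Gowers.FINk n) ∧
      Gowers.IsBlockSeq Gowers.tetrisOps x ∧
      ∀ k ≤ n, Gowers.Monochromatic c (Gowers.FINk k ∩ Gowers.sums Gowers.tetrisOps x)) ∧
    (∃ x : ℕ → Gowers.FIN,
      (∀ i, x i ∈ Gowers.FINk n) ∧
      Gowers.IsBlockSeq Gowers.tetrisIterates x ∧
      ∀ k ≤ n, Gowers.Monochromatic c (Gowers.FINk k ∩ Gowers.sums Gowers.tetrisIterates x)) := by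
  obtain ⟨x, hx, hblock, hmono⟩ := Gowers.exists_blockSeq_monochromatic c n
  refine ⟨⟨x, hx, hblock, hmono⟩, x, hx, fun ℓ k φ hk hφ =>
    hblock ℓ k φ hk fun i => Gowers.tetrisIterates_subset_tetrisOps (hφ i), fun k hk => ?_⟩
  obtain ⟨r, hr⟩ := hmono k hk
  refine ⟨r, fun s hs => hr s ⟨hs.1, ?_⟩⟩
  obtain ⟨ℓ, m, φ, hm, hφ, hs⟩ := hs.2
  exact ⟨ℓ, m, φ, hm, fun i => Gowers.tetrisIterates_subset_tetrisOps (hφ i), hs⟩
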